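/- Let $\varphi=(1+\sqrt5)/2$ be the golden mean. Every natural number $N\ge 0$ can be written in exactly one way as a finite sum $N=\sum_{i\in\mathbb Z} d_i\varphi^i$ with digits $d_i=d_i(N)\in\{0,1\}$, only finitely many of which are nonzero, such that no two consecutive digits $d_i,d_{i+1}$ are both equal to $1$ (the base phi expansion of $N$). Let $s_\beta(N)=\sum_{i} d_i(N)$ be its sum of digits, and let $\mathrm T=(\mathrm T(N))_{N\ge 0}$ be the infinite word over $\{0,1\}$ given by $\mathrm T(N)=s_\beta(N) \bmod 2$. Then the letters $0$ and $1$ both have frequency $\tfrac12$ in $\mathrm T$; that is, for each $a\in\{0,1\}$, $$\lim_{n\to\infty}\frac{\#\{0\le N<n : \mathrm T(N)=a\}}{n}=\frac12 .$$ -/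

import Mathlib

open Filter Topology

namespace BasePhi

/-- A finite digit expansion `(d i)`, `i : ℤ`, with digits `0` and `1` is given by the finite set
`S` of the positions `i` with `d i = 1`. The set is admissible if no two consecutive digits are
both `1`. -/
def Admissible (S : Finset ℤ) : Prop := ∀ i ∈ S, i + 1 ∉ S

/-- The real number `∑ i, d i * φ ^ i`, where `φ` is the golden mean `(1 + √5) / 2`. -/
noncomputable def value (S : Finset ℤ) : ℝ := ∑ i ∈ S, Real.goldenRatio ^ i

/-- `S` is (the set of positions of the digit `1` of) a base phi expansion of `N`. -/
def IsExpansion (N : ℕ) (S : Finset ℤ) : Prop := Admissible S ∧ value S = (N : ℝ)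

theorem zpow_add_zpow (k : ℤ) :
    Real.goldenRatio ^ k + Real.goldenRatio ^ (k + 1) = Real.goldenRatio ^ (k + 2) := by
  have h0 := Real.goldenRatio_ne_zero
  rw [zpow_add₀ h0, zpow_add₀ h0]
  have h2 : Real.goldenRatio ^ (2 : ℤ) = Real.goldenRatio + 1 := by
    exact_mod_cast Real.goldenRatio_sq
  rw [h2, zpow_one]
  ring

theorem two_mul_zpow (k : ℤ) :
    2 * Real.goldenRatio ^ k = Real.goldenRatio ^ (k + 1) + Real.goldenRatio ^ (k - 2) := by
  have h1 := zpow_add_zpow (k - 2)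
  have h2 := zpow_add_zpow (k - 1)
  rw [show k - 2 + 1 = k - 1 by ring, show k - 2 + 2 = k by ring] at h1
  rw [show k - 1 + 1 = k by ring, show k - 1 + 2 = k + 1 by ring] at h2
  linarith

theorem value_erase {S : Finset ℤ} {k : ℤ} (h : k ∈ S) :
    value (S.erase k) + Real.goldenRatio ^ k = value S :=
  Finset.sum_erase_add S _ h

theorem value_insert {S : Finset ℤ} {k : ℤ} (h : k ∉ S) :
    value (insert k S) = Real.goldenRatio ^ k + value S :=
  Finset.sum_insert h

theorem Admissible.erase {S : Finset ℤ} (h : Admissible S) (k : ℤ) : Admissible (S.erase k) :=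
  fun i hi hi' => h i (Finset.mem_of_mem_erase hi) (Finset.mem_of_mem_erase hi')

theorem Admissible.insert {S : Finset ℤ} (h : Admissible S) {k : ℤ} (h1 : k + 1 ∉ S)
    (h2 : k - 1 ∉ S) : Admissible (insert k S) := by
  intro i hi hi'
  rw [Finset.mem_insert] at hi hi'
  rcases hi with rfl | hi
  · rcases hi' with h' | h'
    · omega
    · exact h1 h'
  · rcases hi' with h' | h'
    · exact h2 (by rwa [show k - 1 = i by omega])
    · exact h i hi h'

/-- A power of `φ` can be added to an admissible expansion. -/
theorem exists_add_zpow (n m : ℕ) (S : Finset ℤ) (k : ℤ) (hn : S.card = n)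
    (hm : (S.filter (· ≤ k)).card = m) (hS : Admissible S) :
    ∃ U : Finset ℤ, Admissible U ∧ value U = value S + Real.goldenRatio ^ k ∧
      U.card ≤ S.card + 1 := by
  induction n using Nat.strong_induction_on generalizing m S k with
  | _ n ihn =>
  induction m using Nat.strong_induction_on generalizing S k with
  | _ m ihm =>
  by_cases hk : k ∈ S
  · have hk1 : k + 1 ∉ S := hS k hk
    have hc := Finset.card_erase_add_one hk
    have hv := value_erase hk
    have h2 := two_mul_zpow k
    by_cases hk2 : k + 2 ∈ S
    · have hk2' : k + 2 ∈ S.erase k := Finset.mem_erase.2 ⟨by omega, hk2⟩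
      have hc' := Finset.card_erase_add_one hk2'
      have hv' := value_erase hk2'
      obtain ⟨U, hU, hUv, hUc⟩ := ihn _ (by omega) _ ((S.erase k).erase (k + 2)) (k + 3) rfl rfl
        ((hS.erase k).erase _)
      obtain ⟨V, hV, hVv, hVc⟩ := ihn _ (by omega) _ U (k - 2) rfl rfl hU
      refine ⟨V, hV, ?_, by omega⟩
      have h3 := zpow_add_zpow (k + 1)
      rw [show k + 1 + 1 = k + 2 by ring, show k + 1 + 2 = k + 3 by ring] at h3
      linarith
    · have hk1' : k + 1 ∉ S.erase k := fun h => hk1 (Finset.mem_of_mem_erase h)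
      have hA : Admissible (Insert.insert (k + 1) (S.erase k)) := by
        refine (hS.erase k).insert ?_ ?_
        · intro h
          exact hk2 (by simpa [show k + 1 + 1 = k + 2 by ring] using Finset.mem_of_mem_erase h)
        · simp
      have hv1 := value_insert hk1'
      have hc1 := Finset.card_insert_of_notMem hk1'
      have hlt : ((Insert.insert (k + 1) (S.erase k)).filter (· ≤ k - 2)).card < m := by
        rw [← hm]
        refine Finset.card_lt_card ?_
        rw [Finset.ssubset_iff_of_subset]
        · exact ⟨k, by simp [hk], by simp⟩
        · intro x hx
          simp only [Finset.mem_filter, Finset.mem_insert, Finset.mem_erase] at hx ⊢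
          obtain ⟨h | h, h'⟩ := hx
          · omega
          · exact ⟨h.2, by omega⟩
      obtain ⟨U, hU, hUv, hUc⟩ := ihm _ hlt _ (k - 2) (by omega) rfl hA
      exact ⟨U, hU, by linarith, by omega⟩
  · by_cases hp : k + 1 ∈ S
    · have hc := Finset.card_erase_add_one hp
      have hv := value_erase hp
      have h2 := zpow_add_zpow k
      obtain ⟨U, hU, hUv, hUc⟩ := ihn _ (by omega) _ (S.erase (k + 1)) (k + 2) rfl rfl
        (hS.erase _)
      exact ⟨U, hU, by linarith, by omega⟩
    · by_cases hq : k - 1 ∈ S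
      · have hc := Finset.card_erase_add_one hq
        have hv := value_erase hq
        have h2 := zpow_add_zpow (k - 1)
        rw [show k - 1 + 1 = k by ring, show k - 1 + 2 = k + 1 by ring] at h2
        obtain ⟨U, hU, hUv, hUc⟩ := ihn _ (by omega) _ (S.erase (k - 1)) (k + 1) rfl rfl
          (hS.erase _)
        exact ⟨U, hU, by linarith, by omega⟩
      · refine ⟨Insert.insert k S, hS.insert hp hq, ?_, ?_⟩
        · rw [value_insert hk, add_comm]
        · rw [Finset.card_insert_of_notMem hk]

theorem exists_isExpansion (N : ℕ) : ∃ S, IsExpansion N S := by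
  induction N with
  | zero => exact ⟨∅, fun i hi => absurd hi (Finset.notMem_empty i), by simp [value]⟩
  | succ N ih =>
    obtain ⟨S, hS, hv⟩ := ih
    obtain ⟨U, hU, hUv, -⟩ := exists_add_zpow _ _ S 0 rfl rfl hS
    exact ⟨U, hU, by rw [hUv, hv]; simp⟩

theorem value_lt (S : Finset ℤ) (hS : Admissible S) (m : ℤ) (hm : ∀ i ∈ S, i < m) :
    value S < Real.goldenRatio ^ m := by
  induction hn : S.card generalizing S m with
  | zero =>
    rw [Finset.card_eq_zero] at hn
    subst hn
    simpa [value] using zpow_pos Real.goldenRatio_pos m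
  | succ n ih =>
    have hne : S.Nonempty := Finset.card_pos.1 (by omega)
    have hM := S.max'_mem hne
    set M := S.max' hne with hMdef
    have hc := Finset.card_erase_add_one hM
    have hlt : value (S.erase M) < Real.goldenRatio ^ (M - 1) := by
      refine ih _ (hS.erase M) _ (fun i hi => ?_) (by omega)
      rw [Finset.mem_erase] at hi
      have h1 := S.le_max' i hi.2
      have h2 : i + 1 ≠ M := fun h => hS i hi.2 (h ▸ hM)
      have h3 := hi.1
      omega
    have hv := value_erase hM
    have h2 := zpow_add_zpow (M - 1)
    rw [show M - 1 + 1 = M by ring, show M - 1 + 2 = M + 1 by ring] at h2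
    have hle : Real.goldenRatio ^ (M + 1) ≤ Real.goldenRatio ^ m :=
      zpow_le_zpow_right₀ Real.one_lt_goldenRatio.le (by have := hm M hM; omega)
    linarith

theorem zpow_le_value {S : Finset ℤ} {k : ℤ} (hk : k ∈ S) : Real.goldenRatio ^ k ≤ value S :=
  Finset.single_le_sum (f := fun i : ℤ => Real.goldenRatio ^ i)
    (fun i _ => (zpow_pos Real.goldenRatio_pos i).le) hk

theorem value_injective (S U : Finset ℤ) (hS : Admissible S) (hU : Admissible U)
    (h : value S = value U) : S = U := by
  have key : ∀ A B : Finset ℤ, Admissible A → value A = value B → ∀ b ∈ B, ∃ a ∈ A, b ≤ a := by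
    intro A B hA hAB b hb
    by_contra! hcon
    have h1 := value_lt A hA b hcon
    have h2 := zpow_le_value hb
    linarith
  induction hn : S.card generalizing S U with
  | zero =>
    rw [Finset.card_eq_zero] at hn
    subst hn
    symm
    rw [Finset.eq_empty_iff_forall_notMem]
    intro b hb
    obtain ⟨a, ha, -⟩ := key ∅ U hS h b hb
    exact absurd ha (Finset.notMem_empty a)
  | succ n ih =>
    have hne : S.Nonempty := Finset.card_pos.1 (by omega)
    have hM := S.max'_mem hne
    set M := S.max' hne with hMdef
    obtain ⟨u, hu, hMu⟩ := key U S hU h.symm M hM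
    obtain ⟨a, ha, hua⟩ := key S U hS h u hu
    have haM := S.le_max' a ha
    have huM : u = M := by omega
    rw [huM] at hu
    have hc := Finset.card_erase_add_one hM
    have h1 := value_erase hM
    have h2 := value_erase hu
    have := ih _ _ (hS.erase M) (hU.erase M) (by linarith) (by omega)
    rw [← Finset.insert_erase hM, ← Finset.insert_erase hu, this]

/-- Every natural number has exactly one base phi expansion. -/
theorem existsUnique_isExpansion (N : ℕ) : ∃! S, IsExpansion N S := by
  obtain ⟨S, hS⟩ := exists_isExpansion N
  exact ⟨S, hS, fun U hU => value_injective U S hU.1 hS.1 (hU.2.trans hS.2.symm)⟩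

/-- The base phi expansion of `N`, as the set of the positions of its digits `1`. -/
noncomputable def expansion (N : ℕ) : Finset ℤ := (existsUnique_isExpansion N).choose

theorem isExpansion_expansion (N : ℕ) : IsExpansion N (expansion N) :=
  (existsUnique_isExpansion N).choose_spec.1

theorem IsExpansion.eq_expansion {N : ℕ} {S : Finset ℤ} (h : IsExpansion N S) :
    S = expansion N :=
  (existsUnique_isExpansion N).choose_spec.2 S h

/-- The sum of digits of the base phi expansion of `N`: the digits are `0` and `1`, so this is the
number of digits `1`. -/
noncomputable def sumDigits (N : ℕ) : ℕ := (expansion N).card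

/-- The infinite word `T` over the letters `0` and `1`: the sum of digits modulo 2. -/
noncomputable def T (N : ℕ) : ℕ := sumDigits N % 2

/-- The letter `a` has frequency `f` in the infinite word `w`: the proportion of the occurrences
of `a` among the first `n` letters `w 0, …, w (n - 1)` converges to `f` as `n → ∞`. -/
def HasFrequency {A : Type*} [DecidableEq A] (w : ℕ → A) (a : A) (f : ℝ) : Prop :=
  Tendsto (fun n : ℕ => (((Finset.range n).filter (fun k => w k = a)).card : ℝ) / (n : ℝ))
    atTop (𝓝 f)

end BasePhi

/-!
Let `L` be the Lucas sequence. Since `L k = φ ^ k ± φ ^ (-k)`, the expansions of the numbers in the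
Lucas intervals `[0, L (2n + 1)]` and `(L (2n + 1), L (2n + 2))` arise from those in earlier
intervals by changing a few outer digits. If `A n` and `B n` denote the words of the signs
`(-1) ^ s(N)` over these two intervals, this gives
`A (n + 1) = A n ⬝ B n ⬝ A n` and `B (n + 2) = -B (n + 1) ⬝ A n ⬝ -B (n + 1)`.
The minus signs produce cancellation: eliminating `B` shows that `a n = ∑ A n` satisfies
`a (n + 3) = 4 a (n + 1) + a n`, so it grows like `2.11… ^ n`, whereas the length of `A n` grows
like `φ ^ (2n) = 2.61… ^ n`. The same recursions carry the bound over to all prefixes of `A n`, so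
the signs have mean zero.
-/

namespace BasePhi

open scoped goldenRatio

/-! ### Prefix sums of words -/

/-- The sums of all prefixes of the word `l` are at most `D` in absolute value. -/
def PrefixSumsLE {α : Type*} [AddCommGroup α] [Lattice α] (l : List α) (D : α) : Prop :=
  ∀ k, |(l.take k).sum| ≤ D

namespace PrefixSumsLE

variable {α : Type*} [AddCommGroup α] [LinearOrder α] {l l₁ l₂ l₃ : List α} {C D E : α}

theorem mono (h : PrefixSumsLE l D) (hDE : D ≤ E) : PrefixSumsLE l E := fun k => (h k).trans hDE

theorem map_neg (h : PrefixSumsLE l D) : PrefixSumsLE (l.map Neg.neg) D := fun k => by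
  rw [← List.map_take, ← List.sum_neg, abs_neg]
  exact h k

variable [IsOrderedAddMonoid α]

theorem nonneg (h : PrefixSumsLE l D) : 0 ≤ D := (abs_nonneg _).trans (h 0)

theorem append (h₁ : PrefixSumsLE l₁ (|l₁.sum| + D)) (h₂ : PrefixSumsLE l₂ D) :
    PrefixSumsLE (l₁ ++ l₂) (|l₁.sum| + D) := fun k => by
  rw [List.take_append, List.sum_append]
  rcases le_total k l₁.length with hk | hk
  · simpa only [Nat.sub_eq_zero_of_le hk, List.take_zero, List.sum_nil, add_zero] using h₁ k
  · rw [List.take_of_length_le hk]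
    exact (abs_add_le _ _).trans (add_le_add_right (h₂ _) _)

theorem append_append (h₁ : PrefixSumsLE l₁ D) (h₂ : PrefixSumsLE l₂ D) (h₃ : PrefixSumsLE l₃ D)
    (hC₁ : |l₁.sum| ≤ C) (hC₂ : |l₂.sum| ≤ C) :
    PrefixSumsLE (l₁ ++ l₂ ++ l₃) (C + (C + D)) := by
  have hC : 0 ≤ C := (abs_nonneg _).trans hC₁
  have h₂₃ := ((h₂.mono (le_add_of_nonneg_left (abs_nonneg _))).append h₃).mono
    (add_le_add_left hC₂ D)
  have hD := le_add_of_nonneg_of_le (abs_nonneg l₁.sum) (le_add_of_nonneg_left hC (a := D))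
  rw [List.append_assoc]
  exact ((h₁.mono hD).append h₂₃).mono (add_le_add_left hC₁ _)

end PrefixSumsLE

theorem prefixSumsLE_sum_abs {α : Type*} [AddCommGroup α] [LinearOrder α] [IsOrderedAddMonoid α]
    (l : List α) : PrefixSumsLE l (l.map abs).sum := by
  intro k
  induction l generalizing k with
  | nil => simp
  | cons x l ih =>
    cases k with
    | zero => simpa using add_nonneg (abs_nonneg x) (PrefixSumsLE.nonneg ih)
    | succ k => simpa using (abs_add_le _ _).trans (add_le_add_right (ih k) _)

/-! ### Geometric growth and averages -/

theorem exists_abs_le_mul_pow_of_recurrence {𝕜 : Type*} [Field 𝕜] [LinearOrder 𝕜]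
    [IsStrictOrderedRing 𝕜] {u : ℕ → 𝕜} {p q r : 𝕜} (hp : 0 ≤ p) (hq : 0 ≤ q) (hr : 0 < r)
    (hpqr : p * r + q ≤ r ^ 3) (hu : ∀ n, u (n + 3) = p * u (n + 1) + q * u n) :
    ∃ C, ∀ n, |u n| ≤ C * r ^ n := by
  set C := |u 0| + |u 1| / r + |u 2| / r ^ 2
  have hC_nonneg : 0 ≤ C := by positivity
  suffices h : ∀ n, |u n| ≤ C * r ^ n ∧ |u (n + 1)| ≤ C * r ^ (n + 1) ∧
      |u (n + 2)| ≤ C * r ^ (n + 2) from ⟨C, fun n => (h n).1⟩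
  intro n
  induction n with
  | zero =>
    have h₁ : 0 ≤ |u 1| / r := by positivity
    have h₂ : 0 ≤ |u 2| / r ^ 2 := by positivity
    have h₀ := abs_nonneg (u 0)
    simp only [zero_add, pow_zero, mul_one, pow_one]
    rw [← div_le_iff₀ hr, ← div_le_iff₀ (pow_pos hr 2)]
    exact ⟨by linarith, by linarith, by linarith⟩
  | succ n ih =>
    obtain ⟨h₀, h₁, h₂⟩ := ih
    refine ⟨h₁, h₂, ?_⟩
    calc |u (n + 3)| ≤ p * |u (n + 1)| + q * |u n| := by
          rw [hu]
          refine (abs_add_le _ _).trans_eq ?_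
          rw [abs_mul, abs_mul, abs_of_nonneg hp, abs_of_nonneg hq]
      _ ≤ p * (C * r ^ (n + 1)) + q * (C * r ^ n) := by gcongr
      _ = C * r ^ n * (p * r + q) := by ring
      _ ≤ C * r ^ n * r ^ 3 :=
        mul_le_mul_of_nonneg_left hpqr (mul_nonneg hC_nonneg (pow_nonneg hr.le n))
      _ = C * r ^ (n + 3) := by ring

theorem abs_le_mul_rpow_logb_of_geometric {S : ℕ → ℝ} {ℓ : ℕ → ℕ} {C q r : ℝ} (hq : 1 < q)
    (hr : 1 ≤ r) (hℓ : ∀ k, q ^ k ≤ ℓ k) (hS : ∀ k, ∀ m ≤ ℓ k, |S m| ≤ C * r ^ k) {m : ℕ}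
    (hm : 1 ≤ m) : |S m| ≤ C * r * (m : ℝ) ^ Real.logb q r := by
  have hq₀ : 0 < q := zero_lt_one.trans hq
  have hC : 0 ≤ C := (abs_nonneg _).trans (by simpa using hS 0 0 (Nat.zero_le _))
  obtain ⟨k, hkm, hmk⟩ := exists_nat_pow_near (Nat.one_le_cast.2 hm : (1 : ℝ) ≤ m) hq
  have hm_le : m ≤ ℓ (k + 1) := by exact_mod_cast hmk.le.trans (hℓ (k + 1))
  have h_pow : r ^ k ≤ (m : ℝ) ^ Real.logb q r :=
    calc r ^ k = (q ^ Real.logb q r) ^ k := by rw [Real.rpow_logb hq₀ hq.ne' (by linarith)]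
      _ = (q ^ k) ^ Real.logb q r := Real.rpow_pow_comm hq₀.le _ _
      _ ≤ (m : ℝ) ^ Real.logb q r :=
        Real.rpow_le_rpow (by positivity) hkm (Real.logb_nonneg hq hr)
  calc |S m| ≤ C * r ^ (k + 1) := hS _ m hm_le
    _ = C * r * r ^ k := by ring
    _ ≤ C * r * (m : ℝ) ^ Real.logb q r := by gcongr

theorem tendsto_div_natCast_of_abs_le_mul_rpow {S : ℕ → ℝ} {C θ : ℝ} (hθ : θ < 1)
    (hS : ∀ m : ℕ, 1 ≤ m → |S m| ≤ C * (m : ℝ) ^ θ) :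
    Tendsto (fun m : ℕ => S m / m) atTop (𝓝 0) := by
  have h_rpow : Tendsto (fun m : ℕ => C * (m : ℝ) ^ (-(1 - θ))) atTop (𝓝 0) := by
    simpa only [mul_zero, Function.comp_def] using
      ((tendsto_rpow_neg_atTop (sub_pos.2 hθ)).comp tendsto_natCast_atTop_atTop).const_mul C
  refine squeeze_zero_norm' ?_ h_rpow
  filter_upwards [eventually_ge_atTop 1] with m hm
  have hm₀ : (0 : ℝ) < m := by exact_mod_cast hm
  rw [Real.norm_eq_abs, abs_div, abs_of_pos hm₀, neg_sub, Real.rpow_sub_one hm₀.ne',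
    ← mul_div_assoc]
  exact div_le_div_of_nonneg_right (hS m hm) hm₀.le

theorem hasFrequency_of_tendsto_average {A : Type*} [DecidableEq A] {w : ℕ → A} {a : A} {f : ℝ}
    {e : ℕ → ℝ} (h_indicator : ∀ N, (if w N = a then 1 else 0) = f + e N)
    (h_average : Tendsto (fun n : ℕ => (∑ N ∈ Finset.range n, e N) / n) atTop (𝓝 0)) :
    HasFrequency w a f := by
  have h_sum : Tendsto (fun n : ℕ => f + (∑ N ∈ Finset.range n, e N) / n) atTop (𝓝 f) := by
    simpa only [add_zero] using h_average.const_add f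
  refine h_sum.congr' ?_
  filter_upwards [eventually_gt_atTop 0] with n hn
  have hn₀ : (n : ℝ) ≠ 0 := by exact_mod_cast hn.ne'
  rw [Finset.natCast_card_filter, Finset.sum_congr rfl fun N _ => h_indicator N,
    Finset.sum_add_distrib, Finset.sum_const, Finset.card_range, nsmul_eq_mul, add_div,
    mul_div_cancel_left₀ f hn₀]

/-! ### Lucas numbers -/

/-- The Lucas numbers `2, 1, 3, 4, 7, 11, …`. They delimit the intervals on which the base phi
expansions have a uniform shape. -/
def lucas : ℕ → ℕ
  | 0 => 2
  | 1 => 1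
  | n + 2 => lucas n + lucas (n + 1)

theorem lucas_add_two (n : ℕ) : lucas (n + 2) = lucas n + lucas (n + 1) := rfl

theorem lucas_pos (n : ℕ) : 0 < lucas n := by
  induction n using Nat.twoStepInduction with
  | zero => decide
  | one => decide
  | more n h₀ _ => exact Nat.add_pos_left h₀ _

theorem coe_lucas (n : ℕ) : (lucas n : ℝ) = φ ^ n + ψ ^ n := by
  induction n using Nat.twoStepInduction with
  | zero => norm_num [lucas]
  | one => simp [lucas]
  | more n h₀ h₁ =>
    rw [lucas_add_two, Nat.cast_add, h₀, h₁, pow_add φ n 2, pow_add ψ n 2,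
      Real.goldenRatio_sq, Real.goldenConj_sq]
    ring

theorem goldenConj_eq_neg_zpow : ψ = -φ ^ (-1 : ℤ) := by
  rw [zpow_neg_one, Real.inv_goldenRatio, neg_neg]

theorem coe_lucas_of_even {k : ℕ} (hk : Even k) : (lucas k : ℝ) = φ ^ (k : ℤ) + φ ^ (-k : ℤ) := by
  rw [coe_lucas, goldenConj_eq_neg_zpow, hk.neg_pow, ← zpow_natCast, ← zpow_natCast, ← zpow_mul,
    neg_one_mul]

theorem coe_lucas_of_odd {k : ℕ} (hk : Odd k) : (lucas k : ℝ) = φ ^ (k : ℤ) - φ ^ (-k : ℤ) := by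
  rw [coe_lucas, goldenConj_eq_neg_zpow, hk.neg_pow, ← zpow_natCast, ← zpow_natCast, ← zpow_mul,
    neg_one_mul, sub_eq_add_neg]

theorem sq_goldenRatio_pow_le_lucas (n : ℕ) : (φ ^ 2) ^ n ≤ lucas (2 * n + 1) + 1 := by
  have h_mono : φ ^ (2 * n) ≤ φ ^ (2 * n + 1) :=
    pow_le_pow_right₀ Real.one_lt_goldenRatio.le (Nat.le_succ _)
  have h_conj : |ψ ^ (2 * n + 1)| ≤ 1 := by
    rw [abs_pow]
    exact pow_le_one₀ (abs_nonneg _)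
      (abs_le.2 ⟨Real.neg_one_lt_goldenConj.le, Real.goldenConj_neg.le.trans zero_le_one⟩)
  rw [coe_lucas, ← pow_mul]
  linarith [neg_le_of_abs_le h_conj]

/-! ### Adding digits outside a window -/

section Window

variable {V : Finset ℤ} {a b c d i : ℤ}

theorem notMem_of_subset_Icc (hV : V ⊆ Finset.Icc a b) (hi : i < a ∨ b < i) : i ∉ V := fun h => by
  have := Finset.mem_Icc.1 (hV h)
  omega

theorem notMem_insert_of_subset_Icc (hV : V ⊆ Finset.Icc a b) (hbd : b < d) (hcd : c < d) :
    d ∉ insert c V := by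
  rw [Finset.mem_insert, not_or]
  exact ⟨hcd.ne', notMem_of_subset_Icc hV (.inr hbd)⟩

theorem Admissible.insert_ends (h : Admissible V) (hV : V ⊆ Finset.Icc a b) (hca : c + 1 < a)
    (hbd : b + 1 < d) (hcd : c + 1 < d) : Admissible (Insert.insert d (Insert.insert c V)) := by
  have h_low : Admissible (Insert.insert c V) :=
    h.insert (notMem_of_subset_Icc hV (by omega)) (notMem_of_subset_Icc hV (by omega))
  exact h_low.insert (notMem_insert_of_subset_Icc hV (by omega) (by omega))
    (notMem_insert_of_subset_Icc hV (by omega) (by omega))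

theorem value_insert_ends (hV : V ⊆ Finset.Icc a b) (hca : c < a) (hbd : b < d) (hcd : c < d) :
    value (insert d (insert c V)) = φ ^ d + (φ ^ c + value V) := by
  rw [value_insert (notMem_insert_of_subset_Icc hV hbd hcd),
    value_insert (notMem_of_subset_Icc hV (.inl hca))]

theorem card_insert_ends (hV : V ⊆ Finset.Icc a b) (hca : c < a) (hbd : b < d) (hcd : c < d) :
    (insert d (insert c V)).card = V.card + 2 := by
  rw [Finset.card_insert_of_notMem (notMem_insert_of_subset_Icc hV hbd hcd),
    Finset.card_insert_of_notMem (notMem_of_subset_Icc hV (.inl hca))]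

end Window

/-! ### Recursive structure of the expansions -/

theorem IsExpansion.sumDigits_eq {N : ℕ} {S : Finset ℤ} (h : IsExpansion N S) :
    sumDigits N = S.card := by
  rw [sumDigits, ← h.eq_expansion]

theorem isExpansion_zero : IsExpansion 0 ∅ := ⟨by simp [Admissible], by simp [value]⟩

theorem isExpansion_one : IsExpansion 1 {0} := ⟨by simp [Admissible], by simp [value]⟩

theorem IsExpansion.lucas_even_add {n j : ℕ} {S : Finset ℤ} (h : IsExpansion j S)
    (hS : S ⊆ Finset.Icc (-2 * n : ℤ) (2 * n)) :
    IsExpansion (lucas (2 * n + 2) + j) (insert (2 * n + 2 : ℤ) (insert (-2 * n - 2 : ℤ) S)) := by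
  refine ⟨h.1.insert_ends hS (by omega) (by omega) (by omega), ?_⟩
  have h_lucas := coe_lucas_of_even (k := 2 * n + 2) (by grind)
  rw [value_insert_ends hS (by omega) (by omega) (by omega)]
  linear_combination (norm := (push_cast; ring_nf)) h.2 - h_lucas

/-- `V` is the inner part of the expansion of a number `N` in the `n`-th odd Lucas interval
`(lucas (2n + 1), lucas (2n + 2))`: the whole expansion consists of `V` and the two outermost
positions `2n + 1` and `-2n - 2`, which are kept apart because only they are moved when passing to
the next odd interval. -/
structure IsOddCore (n N : ℕ) (V : Finset ℤ) : Prop where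
  admissible : Admissible V
  subset : V ⊆ Finset.Icc (1 - 2 * n : ℤ) (2 * n - 1)
  value_add : value V + φ ^ (2 * n + 1 : ℤ) + φ ^ (-2 * n - 2 : ℤ) = N

namespace IsOddCore

variable {n N : ℕ} {V : Finset ℤ}

theorem isExpansion (h : IsOddCore n N V) :
    IsExpansion N (insert (2 * n + 1 : ℤ) (insert (-2 * n - 2 : ℤ) V)) := by
  refine ⟨h.admissible.insert_ends h.subset (by omega) (by omega) (by omega), ?_⟩
  rw [value_insert_ends h.subset (by omega) (by omega) (by omega), ← h.value_add]
  ring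

theorem sumDigits_eq (h : IsOddCore n N V) : sumDigits N = V.card + 2 := by
  rw [h.isExpansion.sumDigits_eq,
    card_insert_ends h.subset (by omega) (by omega) (by omega)]

theorem lucas_even_add (h : IsOddCore n N V) :
    IsOddCore (n + 1) (lucas (2 * n + 2) + N) (insert (-2 * n - 1 : ℤ) V) where
  admissible := h.admissible.insert (notMem_of_subset_Icc h.subset (by omega))
    (notMem_of_subset_Icc h.subset (by omega))
  subset := Finset.insert_subset (Finset.mem_Icc.2 (by omega))
    (h.subset.trans (Finset.Icc_subset_Icc (by omega) (by omega)))
  value_add := by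
    have h_top := zpow_add_zpow (2 * n + 1 : ℤ)
    have h_bottom := two_mul_zpow (-2 * n - 2 : ℤ)
    have h_lucas := coe_lucas_of_even (k := 2 * n + 2) (by grind)
    rw [value_insert (notMem_of_subset_Icc h.subset (by omega))]
    linear_combination (norm := (push_cast; ring_nf))
      h.value_add - h_lucas - h_top - h_bottom

theorem lucas_odd_add (h : IsOddCore n N V) :
    IsOddCore (n + 1) (lucas (2 * n + 3) + N) (insert (2 * n + 1 : ℤ) V) where
  admissible := h.admissible.insert (notMem_of_subset_Icc h.subset (by omega))
    (notMem_of_subset_Icc h.subset (by omega))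
  subset := Finset.insert_subset (Finset.mem_Icc.2 (by omega))
    (h.subset.trans (Finset.Icc_subset_Icc (by omega) (by omega)))
  value_add := by
    have h_bottom := zpow_add_zpow (-2 * n - 4 : ℤ)
    have h_lucas := coe_lucas_of_odd (k := 2 * n + 3) (by grind)
    rw [value_insert (notMem_of_subset_Icc h.subset (by omega))]
    linear_combination (norm := (push_cast; ring_nf)) h.value_add - h_lucas + h_bottom

theorem two : IsOddCore 0 2 ∅ where
  admissible := isExpansion_zero.1
  subset := Finset.empty_subset _
  value_add := by
    have h_lucas := coe_lucas_of_even even_two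
    have h_top := zpow_add_zpow 0
    linear_combination (norm := (simp [value, lucas]; ring_nf)) h_top - h_lucas

end IsOddCore

theorem IsExpansion.isOddCore_lucas_add_lucas_add {n j : ℕ} {S : Finset ℤ}
    (h : IsExpansion j S) (hS : S ⊆ Finset.Icc (-2 * n : ℤ) (2 * n)) :
    IsOddCore (n + 2) (lucas (2 * n + 5) + lucas (2 * n + 2) + j)
      (insert (2 * n + 2 : ℤ) (insert (-2 * n - 3 : ℤ) S)) where
  admissible := h.1.insert_ends hS (by omega) (by omega) (by omega)
  subset := Finset.insert_subset (Finset.mem_Icc.2 (by omega)) <|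
    Finset.insert_subset (Finset.mem_Icc.2 (by omega))
      (hS.trans (Finset.Icc_subset_Icc (by omega) (by omega)))
  value_add := by
    have h_bottom := zpow_add_zpow (-2 * n - 4 : ℤ)
    have h_bottom' := zpow_add_zpow (-2 * n - 6 : ℤ)
    have h_even := coe_lucas_of_even (k := 2 * n + 2) (by grind)
    have h_odd := coe_lucas_of_odd (k := 2 * n + 5) (by grind)
    rw [value_insert_ends hS (by omega) (by omega) (by omega)]
    linear_combination (norm := (push_cast; ring_nf))
      h.2 - h_even - h_odd + h_bottom + h_bottom'

theorem expansion_subset_Icc_succ {n : ℕ}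
    (h_even : ∀ k ≤ lucas (2 * n + 1), expansion k ⊆ Finset.Icc (-2 * n : ℤ) (2 * n))
    (h_odd : ∀ k ∈ Set.Ioo (lucas (2 * n + 1)) (lucas (2 * n + 2)), ∃ V, IsOddCore n k V) :
    ∀ k ≤ lucas (2 * n + 3), expansion k ⊆ Finset.Icc (-2 * (n + 1) : ℤ) (2 * (n + 1)) := by
  intro k hk
  rcases le_or_gt k (lucas (2 * n + 1)) with h_le | h_gt
  · exact (h_even k h_le).trans (Finset.Icc_subset_Icc (by omega) (by omega))
  rcases lt_or_ge k (lucas (2 * n + 2)) with h_lt | h_ge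
  · obtain ⟨V, hV⟩ := h_odd k ⟨h_gt, h_lt⟩
    rw [← hV.isExpansion.eq_expansion]
    exact Finset.insert_subset (Finset.mem_Icc.2 (by omega)) <|
      Finset.insert_subset (Finset.mem_Icc.2 (by omega))
        (hV.subset.trans (Finset.Icc_subset_Icc (by omega) (by omega)))
  · obtain ⟨j, rfl⟩ := Nat.exists_eq_add_of_le h_ge
    have h_lucas : lucas (2 * n + 3) = lucas (2 * n + 1) + lucas (2 * n + 2) := lucas_add_two _
    have hj := h_even j (by omega)
    rw [← ((isExpansion_expansion j).lucas_even_add hj).eq_expansion]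
    exact Finset.insert_subset (Finset.mem_Icc.2 (by omega)) <|
      Finset.insert_subset (Finset.mem_Icc.2 (by omega))
        (hj.trans (Finset.Icc_subset_Icc (by omega) (by omega)))

theorem exists_isOddCore_add_two {n : ℕ}
    (h_even : ∀ k ≤ lucas (2 * n + 1), expansion k ⊆ Finset.Icc (-2 * n : ℤ) (2 * n))
    (h_odd : ∀ k ∈ Set.Ioo (lucas (2 * n + 3)) (lucas (2 * n + 4)), ∃ V, IsOddCore (n + 1) k V) :
    ∀ k ∈ Set.Ioo (lucas (2 * n + 5)) (lucas (2 * n + 6)), ∃ V, IsOddCore (n + 2) k V := by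
  rintro k ⟨hk, hk'⟩
  have h₃ : lucas (2 * n + 3) = lucas (2 * n + 1) + lucas (2 * n + 2) := lucas_add_two _
  have h₄ : lucas (2 * n + 4) = lucas (2 * n + 2) + lucas (2 * n + 3) := lucas_add_two _
  have h₅ : lucas (2 * n + 5) = lucas (2 * n + 3) + lucas (2 * n + 4) := lucas_add_two _
  have h₆ : lucas (2 * n + 6) = lucas (2 * n + 4) + lucas (2 * n + 5) := lucas_add_two _
  rcases lt_or_ge k (lucas (2 * n + 5) + lucas (2 * n + 2)) with h_first | h_middle
  · obtain ⟨j, rfl⟩ := Nat.exists_eq_add_of_le (show lucas (2 * n + 4) ≤ k by omega)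
    obtain ⟨V, hV⟩ := h_odd j ⟨by omega, by omega⟩
    exact ⟨_, hV.lucas_even_add⟩
  rcases le_or_gt k (lucas (2 * n + 5) + lucas (2 * n + 3)) with h_middle' | h_last
  · obtain ⟨j, rfl⟩ := Nat.exists_eq_add_of_le h_middle
    exact ⟨_, (isExpansion_expansion j).isOddCore_lucas_add_lucas_add (h_even j (by omega))⟩
  · obtain ⟨j, rfl⟩ := Nat.exists_eq_add_of_le hk.le
    obtain ⟨V, hV⟩ := h_odd j ⟨by omega, by omega⟩
    exact ⟨_, hV.lucas_odd_add⟩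

theorem expansion_subset_Icc_zero :
    ∀ k ≤ lucas 1, expansion k ⊆ Finset.Icc (-2 * (0 : ℕ) : ℤ) (2 * (0 : ℕ)) := by
  intro k hk
  obtain rfl | rfl : k = 0 ∨ k = 1 := Nat.le_one_iff_eq_zero_or_eq_one.1 hk
  · simp [← isExpansion_zero.eq_expansion]
  · simp [← isExpansion_one.eq_expansion]

theorem exists_isOddCore_zero : ∀ k ∈ Set.Ioo (lucas 1) (lucas 2), ∃ V, IsOddCore 0 k V := by
  rintro k ⟨hk, hk'⟩
  obtain rfl : k = 2 := by simp only [lucas] at hk hk'; omega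
  exact ⟨∅, .two⟩

theorem exists_isOddCore_one : ∀ k ∈ Set.Ioo (lucas 3) (lucas 4), ∃ V, IsOddCore 1 k V := by
  rintro k ⟨hk, hk'⟩
  obtain rfl | rfl : k = 5 ∨ k = 6 := by simp only [lucas] at hk hk'; omega
  · exact ⟨_, IsOddCore.two.lucas_even_add⟩
  · exact ⟨_, IsOddCore.two.lucas_odd_add⟩

theorem expansion_subset_Icc_and_exists_isOddCore (n : ℕ) :
    (∀ k ≤ lucas (2 * n + 1), expansion k ⊆ Finset.Icc (-2 * n : ℤ) (2 * n)) ∧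
    (∀ k ∈ Set.Ioo (lucas (2 * n + 1)) (lucas (2 * n + 2)), ∃ V, IsOddCore n k V) ∧
    ∀ k ∈ Set.Ioo (lucas (2 * n + 3)) (lucas (2 * n + 4)), ∃ V, IsOddCore (n + 1) k V := by
  induction n with
  | zero => exact ⟨expansion_subset_Icc_zero, exists_isOddCore_zero, exists_isOddCore_one⟩
  | succ n ih =>
    obtain ⟨h_even, h_odd, h_odd'⟩ := ih
    exact ⟨expansion_subset_Icc_succ h_even h_odd, h_odd', exists_isOddCore_add_two h_even h_odd'⟩

theorem expansion_subset_Icc {n k : ℕ} (hk : k ≤ lucas (2 * n + 1)) :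
    expansion k ⊆ Finset.Icc (-2 * n : ℤ) (2 * n) :=
  (expansion_subset_Icc_and_exists_isOddCore n).1 k hk

theorem exists_isOddCore {n k : ℕ} (hk : k ∈ Set.Ioo (lucas (2 * n + 1)) (lucas (2 * n + 2))) :
    ∃ V, IsOddCore n k V :=
  (expansion_subset_Icc_and_exists_isOddCore n).2.1 k hk

/-! ### Sign words over the Lucas intervals -/

/-- The sign `(-1) ^ s(N)` attached to the sum of digits `s(N)`: the letter `T N`, written
multiplicatively. -/
noncomputable def sign (N : ℕ) : ℝ := (-1) ^ sumDigits N

theorem sign_lucas_even_add {n j : ℕ} (hj : j ≤ lucas (2 * n + 1)) :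
    sign (lucas (2 * n + 2) + j) = sign j := by
  have h_window := expansion_subset_Icc hj
  rw [sign, ((isExpansion_expansion j).lucas_even_add h_window).sumDigits_eq,
    card_insert_ends h_window (by omega) (by omega) (by omega), pow_add, neg_one_sq, mul_one,
    sign, sumDigits]

theorem sign_lucas_even_add_of_mem_Ioo {n k : ℕ}
    (hk : k ∈ Set.Ioo (lucas (2 * n + 1)) (lucas (2 * n + 2))) :
    sign (lucas (2 * n + 2) + k) = -sign k := by
  obtain ⟨V, hV⟩ := exists_isOddCore hk
  rw [sign, sign, hV.lucas_even_add.sumDigits_eq, hV.sumDigits_eq,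
    Finset.card_insert_of_notMem (notMem_of_subset_Icc hV.subset (by omega))]
  ring

theorem sign_lucas_odd_add_of_mem_Ioo {n k : ℕ}
    (hk : k ∈ Set.Ioo (lucas (2 * n + 1)) (lucas (2 * n + 2))) :
    sign (lucas (2 * n + 3) + k) = -sign k := by
  obtain ⟨V, hV⟩ := exists_isOddCore hk
  rw [sign, sign, hV.lucas_odd_add.sumDigits_eq, hV.sumDigits_eq,
    Finset.card_insert_of_notMem (notMem_of_subset_Icc hV.subset (by omega))]
  ring

theorem sign_lucas_add_lucas_add {n j : ℕ} (hj : j ≤ lucas (2 * n + 1)) :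
    sign (lucas (2 * n + 5) + lucas (2 * n + 2) + j) = sign j := by
  have h_window := expansion_subset_Icc hj
  rw [sign, ((isExpansion_expansion j).isOddCore_lucas_add_lucas_add h_window).sumDigits_eq,
    card_insert_ends h_window (by omega) (by omega) (by omega), sign, sumDigits]
  ring

/-- The word `sign a, sign (a + 1), …, sign (a + m - 1)`. -/
noncomputable def signWord (a m : ℕ) : List ℝ := (List.range m).map fun i => sign (a + i)

theorem signWord_add (a m n : ℕ) : signWord a (m + n) = signWord a m ++ signWord (a + m) n := by
  simp [signWord, List.range_add, add_assoc]

theorem signWord_congr {a b m : ℕ} (h : ∀ i < m, sign (a + i) = sign (b + i)) :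
    signWord a m = signWord b m :=
  List.map_congr_left fun i hi => h i (List.mem_range.1 hi)

theorem signWord_eq_map_neg {a b m : ℕ} (h : ∀ i < m, sign (a + i) = -sign (b + i)) :
    signWord a m = (signWord b m).map Neg.neg := by
  rw [signWord, signWord, List.map_map]
  exact List.map_congr_left fun i hi => h i (List.mem_range.1 hi)

theorem sum_take_signWord_zero {k m : ℕ} (hk : k ≤ m) :
    ((signWord 0 m).take k).sum = ∑ N ∈ Finset.range k, sign N := by
  rw [signWord, ← List.map_take, List.take_range, min_eq_left hk]
  simp only [zero_add]
  rfl

/-- The word of the signs over the even Lucas interval `[0, lucas (2n + 1)]`. -/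
noncomputable def evenWord (n : ℕ) : List ℝ := signWord 0 (lucas (2 * n + 1) + 1)

/-- The word of the signs over the odd Lucas interval `(lucas (2n + 1), lucas (2n + 2))`, which has
`lucas (2n) - 1` elements (no truncation, as `lucas` is positive). -/
noncomputable def oddWord (n : ℕ) : List ℝ :=
  signWord (lucas (2 * n + 1) + 1) (lucas (2 * n) - 1)

theorem evenWord_succ (n : ℕ) : evenWord (n + 1) = evenWord n ++ oddWord n ++ evenWord n := by
  have h₀ := lucas_pos (2 * n)
  have h₂ : lucas (2 * n + 2) = lucas (2 * n) + lucas (2 * n + 1) := lucas_add_two _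
  have h₃ : lucas (2 * n + 3) = lucas (2 * n + 1) + lucas (2 * n + 2) := lucas_add_two _
  have h_last : signWord (lucas (2 * n + 2)) (lucas (2 * n + 1) + 1) = evenWord n :=
    signWord_congr fun i hi => by rw [zero_add, sign_lucas_even_add (by omega)]
  have h_len : lucas (2 * (n + 1) + 1) + 1 =
      lucas (2 * n + 1) + 1 + (lucas (2 * n) - 1) + (lucas (2 * n + 1) + 1) := by
    rw [show 2 * (n + 1) + 1 = 2 * n + 3 by ring]
    omega
  rw [evenWord, h_len, signWord_add, signWord_add, zero_add, zero_add,
    show lucas (2 * n + 1) + 1 + (lucas (2 * n) - 1) = lucas (2 * n + 2) by omega, h_last,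
    evenWord, oddWord]

theorem oddWord_add_two (n : ℕ) :
    oddWord (n + 2) =
      (oddWord (n + 1)).map Neg.neg ++ evenWord n ++ (oddWord (n + 1)).map Neg.neg := by
  have h₂ := lucas_pos (2 * n + 2)
  have h₃ : lucas (2 * n + 3) = lucas (2 * n + 1) + lucas (2 * n + 2) := lucas_add_two _
  have h₄ : lucas (2 * n + 4) = lucas (2 * n + 2) + lucas (2 * n + 3) := lucas_add_two _
  have h₅ : lucas (2 * n + 5) = lucas (2 * n + 3) + lucas (2 * n + 4) := lucas_add_two _
  have h_first : signWord (lucas (2 * n + 5) + 1) (lucas (2 * n + 2) - 1) =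
      (oddWord (n + 1)).map Neg.neg :=
    signWord_eq_map_neg fun i hi => by
      have h_sign := sign_lucas_even_add_of_mem_Ioo (n := n + 1)
        (k := lucas (2 * n + 3) + 1 + i) ⟨by grind, by grind⟩
      rwa [show 2 * (n + 1) + 2 = 2 * n + 4 by ring, ← add_assoc, ← add_assoc,
        show lucas (2 * n + 4) + lucas (2 * n + 3) = lucas (2 * n + 5) by omega] at h_sign
  have h_middle : signWord (lucas (2 * n + 5) + lucas (2 * n + 2)) (lucas (2 * n + 1) + 1) =
      evenWord n :=
    signWord_congr fun i hi => by rw [zero_add, sign_lucas_add_lucas_add (by omega)]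
  have h_last : signWord (lucas (2 * n + 5) + lucas (2 * n + 3) + 1) (lucas (2 * n + 2) - 1) =
      (oddWord (n + 1)).map Neg.neg :=
    signWord_eq_map_neg fun i hi => by
      have h_sign := sign_lucas_odd_add_of_mem_Ioo (n := n + 1)
        (k := lucas (2 * n + 3) + 1 + i) ⟨by grind, by grind⟩
      rwa [show 2 * (n + 1) + 3 = 2 * n + 5 by ring, ← add_assoc, ← add_assoc] at h_sign
  have h_len : lucas (2 * (n + 2)) - 1 =
      lucas (2 * n + 2) - 1 + (lucas (2 * n + 1) + 1) + (lucas (2 * n + 2) - 1) := by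
    rw [show 2 * (n + 2) = 2 * n + 4 by ring]
    omega
  rw [oddWord, h_len, signWord_add, signWord_add, show 2 * (n + 2) + 1 = 2 * n + 5 by ring,
    show lucas (2 * n + 5) + 1 + (lucas (2 * n + 2) - 1) = lucas (2 * n + 5) + lucas (2 * n + 2)
      by omega,
    show lucas (2 * n + 5) + 1 + (lucas (2 * n + 2) - 1 + (lucas (2 * n + 1) + 1)) =
      lucas (2 * n + 5) + lucas (2 * n + 3) + 1 by omega, h_first, h_middle, h_last]

/-! ### Cancellation in the sign words -/

theorem sum_evenWord_succ (n : ℕ) :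
    (evenWord (n + 1)).sum = 2 * (evenWord n).sum + (oddWord n).sum := by
  rw [evenWord_succ, List.sum_append, List.sum_append]
  ring

theorem sum_oddWord_add_two (n : ℕ) :
    (oddWord (n + 2)).sum = (evenWord n).sum - 2 * (oddWord (n + 1)).sum := by
  have h_neg : ((oddWord (n + 1)).map Neg.neg).sum = -(oddWord (n + 1)).sum :=
    (List.sum_neg _).symm
  rw [oddWord_add_two, List.sum_append, List.sum_append, h_neg]
  ring

theorem sum_evenWord_add_three (n : ℕ) :
    (evenWord (n + 3)).sum = 4 * (evenWord (n + 1)).sum + (evenWord n).sum := by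
  linear_combination
    sum_evenWord_succ (n + 2) + sum_oddWord_add_two n + 2 * sum_evenWord_succ (n + 1)

theorem exists_abs_sum_evenWord_oddWord_le :
    ∃ C, ∀ n, |(evenWord n).sum| ≤ C * (9 / 4) ^ n ∧ |(oddWord n).sum| ≤ C * (9 / 4) ^ n := by
  -- `9 / 4` is a rational number between the root `2.11…` of `x ^ 3 = 4 * x + 1` and `φ ^ 2`.
  obtain ⟨C, hC⟩ := exists_abs_le_mul_pow_of_recurrence (u := fun n => (evenWord n).sum)
    (r := 9 / 4) zero_le_four zero_le_one (by norm_num) (by norm_num) fun n => by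
      rw [sum_evenWord_add_three, one_mul]
  have hC_nonneg : 0 ≤ C := (abs_nonneg _).trans (by simpa using hC 0)
  refine ⟨17 / 4 * C, fun n => ⟨(hC n).trans (by gcongr; linarith), ?_⟩⟩
  calc |(oddWord n).sum| = |(evenWord (n + 1)).sum - 2 * (evenWord n).sum| := by
        rw [sum_evenWord_succ, add_sub_cancel_left]
    _ ≤ |(evenWord (n + 1)).sum| + 2 * |(evenWord n).sum| := by
        rw [← abs_two (α := ℝ), ← abs_mul, abs_two]
        exact abs_sub _ _
    _ ≤ C * (9 / 4) ^ (n + 1) + 2 * (C * (9 / 4) ^ n) := by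
        gcongr
        exacts [hC _, hC _]
    _ = 17 / 4 * C * (9 / 4) ^ n := by ring

theorem prefixSumsLE_evenWord_oddWord {C K : ℝ}
    (hC : ∀ n, |(evenWord n).sum| ≤ C * (9 / 4) ^ n ∧ |(oddWord n).sum| ≤ C * (9 / 4) ^ n)
    (hCK : 8 / 5 * C ≤ K) (h_even₀ : PrefixSumsLE (evenWord 0) K)
    (h_odd₀ : PrefixSumsLE (oddWord 0) K) (h_odd₁ : PrefixSumsLE (oddWord 1) (K * (9 / 4)))
    (n : ℕ) :
    PrefixSumsLE (evenWord n) (K * (9 / 4) ^ n) ∧ PrefixSumsLE (oddWord n) (K * (9 / 4) ^ n) ∧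
      PrefixSumsLE (oddWord (n + 1)) (K * (9 / 4) ^ (n + 1)) := by
  have hC_nonneg : 0 ≤ C := (abs_nonneg _).trans (by simpa using (hC 0).1)
  have hK_nonneg : 0 ≤ K := h_even₀.nonneg
  -- The constant `8 / 5` in `hCK` is chosen such that `8 / 5 * (9 / 4 - 1) = 2`.
  have h_step (k : ℕ) : C * (9 / 4) ^ k + (C * (9 / 4) ^ k + K * (9 / 4) ^ k) ≤
      K * (9 / 4) ^ (k + 1) :=
    calc _ = (2 * C + K) * (9 / 4) ^ k := by ring
      _ ≤ K * (9 / 4) * (9 / 4) ^ k := by gcongr; linarith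
      _ = K * (9 / 4) ^ (k + 1) := by ring
  induction n with
  | zero => simpa using ⟨h_even₀, h_odd₀, h_odd₁⟩
  | succ n ih =>
    obtain ⟨h_even, h_odd, h_odd'⟩ := ih
    refine ⟨?_, h_odd', ?_⟩
    · rw [evenWord_succ]
      exact (h_even.append_append h_odd h_even (hC n).1 (hC n).2).mono (h_step n)
    · have h_pow : (9 / 4 : ℝ) ^ n ≤ (9 / 4) ^ (n + 1) :=
        pow_le_pow_right₀ (by norm_num) n.le_succ
      have h_sum : |((oddWord (n + 1)).map Neg.neg).sum| ≤ C * (9 / 4) ^ (n + 1) := by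
        rw [← List.sum_neg, abs_neg]
        exact (hC (n + 1)).2
      rw [oddWord_add_two]
      exact (h_odd'.map_neg.append_append (h_even.mono (by gcongr)) h_odd'.map_neg h_sum
        ((hC n).1.trans (by gcongr))).mono (h_step (n + 1))

theorem exists_prefixSumsLE_evenWord :
    ∃ K : ℝ, ∀ n, PrefixSumsLE (evenWord n) (K * (9 / 4) ^ n) := by
  obtain ⟨C, hC⟩ := exists_abs_sum_evenWord_oddWord_le
  have hC_nonneg : 0 ≤ C := (abs_nonneg _).trans (by simpa using (hC 0).1)
  have h_even₀ := prefixSumsLE_sum_abs (evenWord 0)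
  have h_odd₀ := prefixSumsLE_sum_abs (oddWord 0)
  have h_odd₁ := prefixSumsLE_sum_abs (oddWord 1)
  have h_even₀_nonneg := h_even₀.nonneg
  have h_odd₀_nonneg := h_odd₀.nonneg
  have h_odd₁_nonneg := h_odd₁.nonneg
  obtain ⟨K, hK⟩ : ∃ K, K = ((evenWord 0).map abs).sum + ((oddWord 0).map abs).sum +
    ((oddWord 1).map abs).sum + 8 / 5 * C := ⟨_, rfl⟩
  exact ⟨K, fun n => (prefixSumsLE_evenWord_oddWord hC (by linarith) (h_even₀.mono (by linarith))
    (h_odd₀.mono (by linarith)) (h_odd₁.mono (by linarith)) n).1⟩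

theorem exists_abs_sum_sign_le : ∃ K : ℝ, ∀ n, ∀ m ≤ lucas (2 * n + 1) + 1,
    |∑ N ∈ Finset.range m, sign N| ≤ K * (9 / 4) ^ n := by
  obtain ⟨K, hK⟩ := exists_prefixSumsLE_evenWord
  refine ⟨K, fun n m hm => ?_⟩
  rw [← sum_take_signWord_zero hm]
  exact hK n m

theorem tendsto_average_sign :
    Tendsto (fun n : ℕ => (∑ N ∈ Finset.range n, sign N) / n) atTop (𝓝 0) := by
  obtain ⟨K, hK⟩ := exists_abs_sum_sign_le
  have h_lt : 9 / 4 < φ ^ 2 := by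
    nlinarith [Real.goldenRatio_sq, Real.goldenRatio_pos]
  have h_theta : Real.logb (φ ^ 2) (9 / 4) < 1 := by
    rw [Real.logb_lt_iff_lt_rpow (by linarith) (by norm_num), Real.rpow_one]
    exact h_lt
  exact tendsto_div_natCast_of_abs_le_mul_rpow h_theta fun m =>
    abs_le_mul_rpow_logb_of_geometric (by linarith) (by norm_num)
      (fun k => by exact_mod_cast sq_goldenRatio_pow_le_lucas k) hK

theorem ite_mod_two_eq_half_add {a : ℕ} (ha : a < 2) (s : ℕ) :
    (if s % 2 = a then 1 else 0 : ℝ) = 1 / 2 + (-1) ^ a / 2 * (-1) ^ s := by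
  rcases Nat.even_or_odd s with hs | hs <;> interval_cases a <;>
    norm_num [hs.neg_one_pow, Nat.even_iff.1, Nat.odd_iff.1, hs]

theorem hasFrequency_T {a : ℕ} (ha : a < 2) : HasFrequency T a (1 / 2) := by
  refine hasFrequency_of_tendsto_average (fun N => ite_mod_two_eq_half_add ha (sumDigits N)) ?_
  simpa only [← Finset.mul_sum, mul_div_assoc, mul_zero, sign] using
    tendsto_average_sign.const_mul ((-1) ^ a / 2)

end BasePhi

theorem mainTheorem2 :
    BasePhi.HasFrequency BasePhi.T 0 (1 / 2) ∧ BasePhi.HasFrequency BasePhi.T 1 (1 / 2) :=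
  ⟨BasePhi.hasFrequency_T zero_lt_two, BasePhi.hasFrequency_T one_lt_two⟩
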